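/- Consider initial value problems $y'(t)+My(t)=f(y(t))$ on $[t_0,t_{\rm end}]$, $y(t_0)=y_0$, where $M\in\mathbb R^{m\times m}$ ($m$ arbitrary) is symmetric positive definite or skew-symmetric and $f$ is of class $C^k$ near $y_0$, with $4\le k\le\infty$ fixed. For real coefficients $a_{ij},b_i$ ($i,j\in\{1,2\}$) put $c_i=a_{i1}+a_{i2}$ and consider the two-stage implicit simplified exponential Runge–Kutta (IMSVERK) method with step size $h>0$ $$Y_i=e^{-c_ihM}y_0+h\big(a_{i1}f(Y_1)+a_{i2}f(Y_2)\big)\ (i=1,2),\qquad y_1=e^{-hM}y_0+h\big(b_1f(Y_1)+b_2f(Y_2)\big)+w_4,$$ where, with $g=-My_0+f(y_0)$ and $f=f(y_0)$, $f'=f'(y_0)$, $f''=f''(y_0)$ in the following formula, $$\begin{aligned}w_4={}&-\tfrac{h^2}{2!}Mf+\tfrac{h^3}{3!}\big((M-f')Mf-Mf'g\big)+\tfrac{h^4}{4!}\Big((-M+f')M^2f+M^2f'g-Mf''(g,g)\\&-Mf'(-M+f')g-f'Mf'g-f'f'Mf+3f''(-Mf,g)\Big).\end{aligned}$$ The method is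 said to have order $p$ if for every such problem and every solution $y$ of it there are $h_0,r>0$ and $C$ such that, for all $0<h\le h_0$, the stage equations have exactly one solution $(Y_1,Y_2)$ with $\|Y_i-y_0\|\le r$ ($i=1,2$), and the corresponding $y_1$ satisfies $\|y_1-y(t_0+h)\|\le Ch^{p+1}$. Theorem. (a) If the coefficients satisfy the eight classical order conditions $$\sum_i b_i=1,\quad \sum_i b_ic_i=\tfrac12,\quad \sum_i b_ic_i^2=\tfrac13,\quad \sum_{i,j} b_ia_{ij}c_j=\tfrac16,$$ $$\sum_i b_ic_i^3=\tfrac14,\quad \sum_{i,j} b_ic_ia_{ij}c_j=\tfrac18,\quad \sum_{i,j} b_ia_{ij}c_j^2=\tfrac1{12},\quad \sum_{i,j,l} b_ia_{ij}a_{jl}c_l=\tfrac1{24},$$ then the method has order four. (b) Up to interchanging the two stages, there is exactly one choice of coefficients that satisfies the order conditions, and it is also the only one for which the method has order four, namely the Gauss–Legendre (Hammer–Hollingsworth) coefficients $$a_{11}=a_{22}=\tfrac14,\quad a_{12}=\tfrac{3-2\sqrt3}{12},\quad a_{21}=\tfrac{3+2\sqrt3}{12},\quad b_1=b_2=\tfrac12,\quad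 c_{1}=\tfrac{3-\sqrt3}{6},\quad c_2=\tfrac{3+\sqrt3}{6}.$$ -/

import Mathlib

namespace IMSVERK

/-- The real constant coefficients `a i j`, `b i` of an `s`-stage method. -/
@[ext]
structure Tableau (s : ℕ) where
  a : Fin s → Fin s → ℝ
  b : Fin s → ℝ

/-- The nodes `c i = ∑ j, a i j`. -/
def Tableau.c {s : ℕ} (T : Tableau s) (i : Fin s) : ℝ := ∑ j, T.a i j

/-- The same method with its stages numbered in the opposite order. -/
def Tableau.rev {s : ℕ} (T : Tableau s) : Tableau s where
  a := fun i j => T.a i.rev j.rev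
  b := fun i => T.b i.rev

/-- The eight classical Runge–Kutta order conditions up to order four, for two stages. -/
structure Tableau.OrderConditions (T : Tableau 2) : Prop where
  cond1 : T.b 0 + T.b 1 = 1
  cond2 : T.b 0 * T.c 0 + T.b 1 * T.c 1 = 1 / 2
  cond3 : T.b 0 * T.c 0 ^ 2 + T.b 1 * T.c 1 ^ 2 = 1 / 3
  cond4 : T.b 0 * (T.a 0 0 * T.c 0 + T.a 0 1 * T.c 1)
      + T.b 1 * (T.a 1 0 * T.c 0 + T.a 1 1 * T.c 1) = 1 / 6
  cond5 : T.b 0 * T.c 0 ^ 3 + T.b 1 * T.c 1 ^ 3 = 1 / 4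
  cond6 : T.b 0 * T.c 0 * (T.a 0 0 * T.c 0 + T.a 0 1 * T.c 1)
      + T.b 1 * T.c 1 * (T.a 1 0 * T.c 0 + T.a 1 1 * T.c 1) = 1 / 8
  cond7 : T.b 0 * (T.a 0 0 * T.c 0 ^ 2 + T.a 0 1 * T.c 1 ^ 2)
      + T.b 1 * (T.a 1 0 * T.c 0 ^ 2 + T.a 1 1 * T.c 1 ^ 2) = 1 / 12
  cond8 : (T.b 0 * T.a 0 0 + T.b 1 * T.a 1 0) * (T.a 0 0 * T.c 0 + T.a 0 1 * T.c 1)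
      + (T.b 0 * T.a 0 1 + T.b 1 * T.a 1 1) * (T.a 1 0 * T.c 0 + T.a 1 1 * T.c 1) = 1 / 24

/-- The two-stage Gauss–Legendre coefficients of Hammer and Hollingsworth. -/
noncomputable def gaussLegendre : Tableau 2 where
  a := ![![1 / 4, (3 - 2 * √3) / 12], ![(3 + 2 * √3) / 12, 1 / 4]]
  b := ![1 / 2, 1 / 2]

/-- A real `m × m` matrix as a linear operator on Euclidean space. -/
noncomputable abbrev op {m : ℕ} (M : Matrix (Fin m) (Fin m) ℝ) :
    EuclideanSpace ℝ (Fin m) →L[ℝ] EuclideanSpace ℝ (Fin m) :=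
  Matrix.toEuclideanCLM (n := Fin m) (𝕜 := ℝ) M

/-- The vector `e^{-tM} v`. -/
noncomputable def expNeg {m : ℕ} (M : Matrix (Fin m) (Fin m) ℝ) (t : ℝ)
    (v : EuclideanSpace ℝ (Fin m)) : EuclideanSpace ℝ (Fin m) :=
  NormedSpace.exp (-(t • op M)) v

/-- The explicit correction term `w_4` at step size `h`; here `L = M`, `F = f'(y₀)`,
`B = f''(y₀)`, `v = f(y₀)` and `g = -M y₀ + f(y₀)`. -/
noncomputable def w4 {m : ℕ} (M : Matrix (Fin m) (Fin m) ℝ)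
    (f : EuclideanSpace ℝ (Fin m) → EuclideanSpace ℝ (Fin m))
    (y₀ : EuclideanSpace ℝ (Fin m)) (h : ℝ) : EuclideanSpace ℝ (Fin m) :=
  let L := op M
  let F := fderiv ℝ f y₀
  let B := fderiv ℝ (fderiv ℝ f) y₀
  let v := f y₀
  let g := -L y₀ + v;
  (-(h ^ 2 / 2)) • L v
    + (h ^ 3 / 6) • ((L - F) (L v) - L (F g))
    + (h ^ 4 / 24) • ((-L + F) (L (L v)) + L (L (F g)) - L (B g g) - L (F ((-L + F) g))
        - F (L (F g)) - F (F (L v)) + (3 : ℝ) • B (-L v) g)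

/-- `Y` solves the stage equations
`Y i = e^{-c i h M} y₀ + h ∑ j, a i j f(Y j)`. -/
def Tableau.IsStages {s m : ℕ} (T : Tableau s) (M : Matrix (Fin m) (Fin m) ℝ)
    (f : EuclideanSpace ℝ (Fin m) → EuclideanSpace ℝ (Fin m))
    (y₀ : EuclideanSpace ℝ (Fin m)) (h : ℝ) (Y : Fin s → EuclideanSpace ℝ (Fin m)) : Prop :=
  ∀ i, Y i = expNeg M (T.c i * h) y₀ + h • ∑ j, T.a i j • f (Y j)

/-- The update `y₁ = e^{-hM} y₀ + h ∑ i, b i f(Y i) + w_4`. -/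
noncomputable def Tableau.update {s m : ℕ} (T : Tableau s) (M : Matrix (Fin m) (Fin m) ℝ)
    (f : EuclideanSpace ℝ (Fin m) → EuclideanSpace ℝ (Fin m))
    (y₀ : EuclideanSpace ℝ (Fin m)) (h : ℝ) (Y : Fin s → EuclideanSpace ℝ (Fin m)) :
    EuclideanSpace ℝ (Fin m) :=
  expNeg M h y₀ + h • ∑ i, T.b i • f (Y i) + w4 M f y₀ h

/-- `y` solves `y' + M y = f(y)` on `[t₀, tEnd]` with `y(t₀) = y₀`. -/
def IsSolution {m : ℕ} (M : Matrix (Fin m) (Fin m) ℝ)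
    (f : EuclideanSpace ℝ (Fin m) → EuclideanSpace ℝ (Fin m)) (t₀ tEnd : ℝ)
    (y₀ : EuclideanSpace ℝ (Fin m)) (y : ℝ → EuclideanSpace ℝ (Fin m)) : Prop :=
  y t₀ = y₀ ∧ ∀ t ∈ Set.Icc t₀ tEnd,
    HasDerivWithinAt y (-op M (y t) + f (y t)) (Set.Icc t₀ tEnd) t

/-- The method with coefficients `T` and correction term `w_4` has order `p` (for nonlinearities
of class `C^k` near `y₀`): for all small `h > 0` the implicit stage equations have exactly one
solution near `y₀`, and the resulting `y₁` agrees with `y(t₀ + h)` up to `O(h^(p+1))`. The matrix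
`M` ranges over the symmetric positive definite and the skew-symmetric matrices of any size. -/
def Tableau.HasOrder {s : ℕ} (T : Tableau s) (k : ℕ∞) (p : ℕ) : Prop :=
  ∀ (m : ℕ) (M : Matrix (Fin m) (Fin m) ℝ), (M.PosDef ∨ M.transpose = -M) →
  ∀ (f : EuclideanSpace ℝ (Fin m) → EuclideanSpace ℝ (Fin m)) (y₀ : EuclideanSpace ℝ (Fin m)),
  ContDiffAt ℝ k f y₀ →
  ∀ (t₀ tEnd : ℝ), t₀ < tEnd →
  ∀ y : ℝ → EuclideanSpace ℝ (Fin m), IsSolution M f t₀ tEnd y₀ y →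
  ∃ h₀ > 0, ∃ r > 0, ∃ C : ℝ, ∀ h : ℝ, 0 < h → h ≤ h₀ →
    (∃! Y : Fin s → EuclideanSpace ℝ (Fin m),
      (∀ i, ‖Y i - y₀‖ ≤ r) ∧ T.IsStages M f y₀ h Y) ∧
    ∀ Y : Fin s → EuclideanSpace ℝ (Fin m),
      (∀ i, ‖Y i - y₀‖ ≤ r) → T.IsStages M f y₀ h Y →
      ‖T.update M f y₀ h Y - y (t₀ + h)‖ ≤ C * h ^ (p + 1)

end IMSVERK

/-!
For small `h` the stage equations are a fixed point problem for a map with Lipschitz constant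
`O(h)`, so the contraction principle on a closed ball around `y₀` on which `f` is Lipschitz gives
exactly one solution there (`eventually_existsUnique_stages`).

For the order, both `y(t₀ + h)` and `y₁` are expanded in powers of `h` with an `O(h⁵)` remainder.
The common tool is the third order Taylor formula of `f` at `y₀` with remainder `O(‖d‖⁴)`
(`ContDiffAt.taylor_three_isBigO`), applied along a curve that is known up to `O(h⁴)`
(`ContDiffAt.comp_cubic_expansion`). The stages are within `O(h⁴)` of a cubic polynomial in `h`,
because this polynomial satisfies the stage equations up to `O(h⁴)` and the stage map contracts
(`stages_expansion`). The solution is within `O(h⁵)` of a quartic polynomial, because the polynomial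
satisfies the differential equation up to `O(h⁴)` and Grönwall's inequality applies
(`solution_expansion`). Comparing coefficients, the order conditions make the
elementary differentials produced by the stages agree with those of the exact solution, except for
terms that do not depend on the coefficients of the method, and these add up to `w₄`
(`Tableau.OrderConditions.update_sub_solution_isBigO`).

Conversely, `M = 0` is skew-symmetric and makes `w₄` vanish. The problem
`x₀' = 1`, `x₁' = x₀`, `x₂' = x₀ ^ q * x₁ ^ e` then isolates a single order condition: both the
exact and the numerical value of `x₂` are multiples of `h ^ (q + 2e + 1)`
(`Tableau.HasOrder.sum_monomial_eq`). This yields the first six order conditions, which already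
determine the tableau up to the numbering of the stages (`Tableau.eq_gaussLegendre_or_rev`): the
four quadrature conditions say that the nodes are the roots of `x² - x + 1/6` with weights `1/2`,
and the other two are then linear equations for the remaining coefficients.
-/

section Expansions

set_option maxSynthPendingDepth 3

open Asymptotics Filter Topology Metric

variable {E F : Type*} [NormedAddCommGroup E] [NormedSpace ℝ E]
  [NormedAddCommGroup F] [NormedSpace ℝ F]

/-! ### Taylor expansion along a curve -/

/-- One integration step of Taylor's formula: an `n`-th order approximation `p'` of the derivative
of `G` integrates to an `(n + 1)`-st order approximation of `G`. Only the derivative of `p` along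
rays is needed, so `p'` need not be the Fréchet derivative of `p` and no symmetry of higher
derivatives is used. -/
theorem isBigO_sub_of_fderiv_sub_isBigO {G p : E → F} {p' : E → E →L[ℝ] F} {x₀ : E} {n : ℕ}
    (hG : ∀ᶠ x in 𝓝 x₀, DifferentiableAt ℝ G x)
    (hp : ∀ (d : E) (s : ℝ), HasDerivAt (fun s : ℝ => p (s • d)) (p' (s • d) d) s)
    (h : (fun x => fderiv ℝ G (x₀ + x) - p' x) =O[𝓝 0] fun x => ‖x‖ ^ n) :
    (fun d => G (x₀ + d) - G x₀ - (p d - p 0)) =O[𝓝 0] fun d => ‖d‖ ^ (n + 1) := by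
  obtain ⟨C, hC, h⟩ := h.exists_nonneg
  have hG' : ∀ᶠ x in 𝓝 (0 : E), DifferentiableAt ℝ G (x₀ + x) := by
    have : Tendsto (fun x => x₀ + x) (𝓝 (0 : E)) (𝓝 x₀) := by
      simpa using (Continuous.tendsto (by fun_prop : Continuous fun x : E => x₀ + x) 0)
    exact this.eventually hG
  obtain ⟨ρ, hρ, hb⟩ := Metric.eventually_nhds_iff_ball.1 (h.bound.and hG')
  refine IsBigO.of_bound C ?_
  filter_upwards [ball_mem_nhds (0 : E) hρ] with d hd
  have hmem : ∀ s ∈ Set.Icc (0 : ℝ) 1, s • d ∈ ball (0 : E) ρ := by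
    intro s hs
    simp only [mem_ball_zero_iff, norm_smul, Real.norm_eq_abs, abs_of_nonneg hs.1] at hd ⊢
    nlinarith [norm_nonneg d, hs.2]
  have key := norm_image_sub_le_of_norm_deriv_le_segment_01'
    (f := fun s : ℝ => G (x₀ + s • d) - p (s • d))
    (f' := fun s : ℝ => fderiv ℝ G (x₀ + s • d) d - p' (s • d) d) (C := C * ‖d‖ ^ (n + 1)) ?_ ?_
  · simp only [one_smul, zero_smul, add_zero] at key
    rw [Real.norm_of_nonneg (by positivity)]
    convert key using 2
    abel
  · intro s hs
    refine (HasDerivAt.sub ?_ (hp d s)).hasDerivWithinAt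
    have h1 : HasDerivAt (fun s : ℝ => x₀ + s • d) d s := by
      simpa using ((hasDerivAt_id s).smul_const d).const_add x₀
    exact (hb _ (hmem s hs)).2.hasFDerivAt.comp_hasDerivAt s h1
  · intro s hs
    have hs' : s ∈ Set.Icc (0 : ℝ) 1 := ⟨hs.1, hs.2.le⟩
    have h1 := (hb _ (hmem s hs')).1
    rw [Real.norm_of_nonneg (by positivity)] at h1
    have h2 : ‖s • d‖ ≤ ‖d‖ := by
      rw [norm_smul, Real.norm_of_nonneg hs.1]
      nlinarith [norm_nonneg d, hs.2]
    calc ‖fderiv ℝ G (x₀ + s • d) d - p' (s • d) d‖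
        = ‖(fderiv ℝ G (x₀ + s • d) - p' (s • d)) d‖ := by simp
      _ ≤ ‖fderiv ℝ G (x₀ + s • d) - p' (s • d)‖ * ‖d‖ := ContinuousLinearMap.le_opNorm _ _
      _ ≤ C * ‖s • d‖ ^ n * ‖d‖ := by gcongr
      _ ≤ C * ‖d‖ ^ n * ‖d‖ := by gcongr
      _ = C * ‖d‖ ^ (n + 1) := by ring

theorem ContDiffAt.eventually_differentiableAt {f : E → F} {x₀ : E} {n : ℕ}
    (hf : ContDiffAt ℝ (n + 1 : ℕ) f x₀) : ∀ᶠ x in 𝓝 x₀, DifferentiableAt ℝ f x := by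
  filter_upwards [hf.eventually (by simp)] with x hx
  exact hx.differentiableAt (by simp)

/-- Third order Taylor formula in several variables, with the derivatives as iterated `fderiv`s. -/
theorem ContDiffAt.taylor_three_isBigO {f : E → F} {x₀ : E} (hf : ContDiffAt ℝ 4 f x₀) :
    (fun d => f (x₀ + d) - (f x₀ + fderiv ℝ f x₀ d + (1 / 2 : ℝ) • fderiv ℝ (fderiv ℝ f) x₀ d d
      + (1 / 6 : ℝ) • fderiv ℝ (fderiv ℝ (fderiv ℝ f)) x₀ d d d)) =O[𝓝 0] fun d => ‖d‖ ^ 4 := by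
  have h1 : ContDiffAt ℝ 3 (fderiv ℝ f) x₀ := hf.fderiv_right (by norm_num)
  have h2 : ContDiffAt ℝ 2 (fderiv ℝ (fderiv ℝ f)) x₀ := h1.fderiv_right (by norm_num)
  have h3 : ContDiffAt ℝ 1 (fderiv ℝ (fderiv ℝ (fderiv ℝ f))) x₀ := h2.fderiv_right (by norm_num)
  set B := fderiv ℝ (fderiv ℝ f) x₀
  set T := fderiv ℝ (fderiv ℝ (fderiv ℝ f)) x₀
  -- Starting from differentiability of the third derivative, integrate three times.
  have e3 : (fun x => fderiv ℝ (fderiv ℝ (fderiv ℝ f)) (x₀ + x) - T) =O[𝓝 0]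
      fun x => ‖x‖ ^ 1 := by
    have := (h3.differentiableAt (by simp)).isBigO_sub
    have ht : Tendsto (fun x => x₀ + x) (𝓝 (0 : E)) (𝓝 x₀) := by
      simpa using (Continuous.tendsto (by fun_prop : Continuous fun x : E => x₀ + x) 0)
    have := this.comp_tendsto ht
    simpa [Function.comp_def] using this.norm_right
  have lin : ∀ (s : ℝ), HasDerivAt (fun s : ℝ => s) 1 s := fun s => hasDerivAt_id s
  have e2 := isBigO_sub_of_fderiv_sub_isBigO (p := fun x => T x) (p' := fun _ => T)
    (ContDiffAt.eventually_differentiableAt (n := 1) h2)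
    (fun d s => by simpa using (lin s).smul_const (T d)) e3
  have e1 := isBigO_sub_of_fderiv_sub_isBigO (G := fderiv ℝ f)
    (p := fun x => B x + (1 / 2 : ℝ) • T x x) (p' := fun x => B + T x)
    (ContDiffAt.eventually_differentiableAt (n := 2) h1)
    (fun d s => by
      have := ((lin s).smul_const (B d)).add ((((lin s).pow 2).smul_const ((1 / 2 : ℝ) • T d d)))
      simp only [map_smul, smul_apply, add_apply]
      convert! this using 1
      · funext s; simp only [Pi.add_apply, Pi.pow_apply]; module
      · simp; module) (e2.congr_left fun x => by simp; abel)
  have e0 := isBigO_sub_of_fderiv_sub_isBigO (G := f)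
    (p := fun x => fderiv ℝ f x₀ x + (1 / 2 : ℝ) • B x x + (1 / 6 : ℝ) • T x x x)
    (p' := fun x => fderiv ℝ f x₀ + (B x + (1 / 2 : ℝ) • T x x))
    (ContDiffAt.eventually_differentiableAt (n := 3) hf)
    (fun d s => by
      have := (((lin s).smul_const (fderiv ℝ f x₀ d)).add
        ((((lin s).pow 2).smul_const ((1 / 2 : ℝ) • B d d)))).add
        ((((lin s).pow 3).smul_const ((1 / 6 : ℝ) • T d d d)))
      simp only [map_smul, smul_apply, add_apply]
      convert! this using 1
      · funext s; simp only [Pi.add_apply, Pi.pow_apply]; module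
      · simp; module) (e1.congr_left fun x => by simp; abel)
  refine e0.congr_left fun x => ?_
  simp
  abel

theorem Asymptotics.IsBigO.clm_apply_mul {ι : Type*} {l : Filter ι} {A : ι → E →L[ℝ] F} {u : ι → E}
    {φ ψ : ι → ℝ} (hA : A =O[l] φ) (hu : u =O[l] ψ) :
    (fun i => A i (u i)) =O[l] fun i => φ i * ψ i :=
  (IsBigO.of_norm_le fun i => by
    simpa using (A i).le_opNorm (u i) : (fun i => A i (u i)) =O[l] fun i => ‖A i‖ * ‖u i‖).trans
    (hA.norm_left.mul hu.norm_left)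

theorem isBigO_pow_pow_of_le_nhds_zero {l : Filter ℝ} (hl : l ≤ 𝓝 0) {m n : ℕ} (hmn : m ≤ n) :
    (fun h : ℝ => h ^ n) =O[l] fun h => h ^ m := by
  refine IsBigO.of_bound 1 (hl ?_)
  filter_upwards [closedBall_mem_nhds (0 : ℝ) one_pos] with h hh
  rw [mem_closedBall_zero_iff] at hh
  simpa using pow_le_pow_of_le_one (norm_nonneg h) hh hmn

/-- The composition of `f` with a curve that is a cubic polynomial up to `O(h⁴)`. By the symmetry of
`f''` the two mixed terms of order `h³` are combined into one. -/
theorem ContDiffAt.comp_cubic_expansion {f : E → F} {x₀ : E} (hf : ContDiffAt ℝ 4 f x₀)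
    {l : Filter ℝ} (hl : l ≤ 𝓝 0) {Z : ℝ → E} {z₁ z₂ z₃ : E}
    (hZ : (fun h : ℝ => Z h - (x₀ + h • z₁ + h ^ 2 • z₂ + h ^ 3 • z₃)) =O[l] fun h => h ^ 4) :
    (fun h : ℝ => f (Z h) - (f x₀ + h • fderiv ℝ f x₀ z₁
      + h ^ 2 • (fderiv ℝ f x₀ z₂ + (1 / 2 : ℝ) • fderiv ℝ (fderiv ℝ f) x₀ z₁ z₁)
      + h ^ 3 • (fderiv ℝ f x₀ z₃ + fderiv ℝ (fderiv ℝ f) x₀ z₂ z₁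
        + (1 / 6 : ℝ) • fderiv ℝ (fderiv ℝ (fderiv ℝ f)) x₀ z₁ z₁ z₁))) =O[l] fun h => h ^ 4 := by
  have sym : ∀ u v, fderiv ℝ (fderiv ℝ f) x₀ u v = fderiv ℝ (fderiv ℝ f) x₀ v u :=
    fun u v => (hf.isSymmSndFDerivAt (by simp; norm_num)).eq u v
  have tay := hf.taylor_three_isBigO
  set D := fderiv ℝ f x₀
  set B := fderiv ℝ (fderiv ℝ f) x₀
  set T := fderiv ℝ (fderiv ℝ (fderiv ℝ f)) x₀
  have mono := @isBigO_pow_pow_of_le_nhds_zero l hl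
  have pw : ∀ (n : ℕ) (v : E), (fun h : ℝ => h ^ n • v) =O[l] fun h => h ^ n := fun n v => by
    simpa using (isBigO_refl (fun h : ℝ => h ^ n) l).smul (isBigO_const_const v (one_ne_zero' ℝ) l)
  -- The increment `d` and its remainders after one, two and three terms.
  set d : ℝ → E := fun h => Z h - x₀
  set e₁ : ℝ → E := fun h => d h - h • z₁
  set e₂ : ℝ → E := fun h => d h - h • z₁ - h ^ 2 • z₂
  set R : ℝ → E := fun h => d h - h • z₁ - h ^ 2 • z₂ - h ^ 3 • z₃
  have hR : R =O[l] fun h => h ^ 4 := hZ.congr_left fun h => by simp only [R, d]; abel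
  have he₂ : e₂ =O[l] fun h => h ^ 3 :=
    ((hR.trans (mono (by norm_num))).add (pw 3 z₃)).congr_left fun h => by simp only [R, e₂]; abel
  have he₁ : e₁ =O[l] fun h => h ^ 2 :=
    ((he₂.trans (mono (by norm_num))).add (pw 2 z₂)).congr_left fun h => by simp only [e₁, e₂]; abel
  have hd : d =O[l] fun h => h ^ 1 :=
    ((he₁.trans (mono (by norm_num))).add (pw 1 z₁)).congr_left fun h => by simp only [e₁]; simp
  have hd0 : Tendsto d l (𝓝 0) := hd.trans_tendsto (by
    simpa using! tendsto_id.mono_left hl)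
  have t1 := (tay.comp_tendsto hd0).trans (hd.norm_left.pow 4)
  have bil : ∀ {u v : ℝ → E} {m n : ℕ}, u =O[l] (fun h => h ^ m) → v =O[l] (fun h => h ^ n) →
      m + n = 4 → (fun h => B (u h) (v h)) =O[l] fun h => h ^ 4 := fun {u v m n} hu hv hmn =>
    (((B.isBigO_comp u l).trans hu).clm_apply_mul hv).congr_right fun h => by rw [← hmn, pow_add]
  have tri : ∀ {u v w : ℝ → E} {m n k : ℕ}, u =O[l] (fun h => h ^ m) → v =O[l] (fun h => h ^ n) →
      w =O[l] (fun h => h ^ k) →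
      m + n + k = 4 → (fun h => T (u h) (v h) (w h)) =O[l] fun h => h ^ 4 :=
    fun {u v w m n k} hu hv hw hmnk =>
    ((((T.isBigO_comp u l).trans hu).clm_apply_mul hv).clm_apply_mul hw).congr_right
      fun h => by rw [← hmnk, pow_add, pow_add]
  -- The errors of the linear, quadratic and cubic terms of Taylor's formula, written so that every
  -- summand is visibly `O(h⁴)`.
  have r1 : (fun h => D (R h)) =O[l] fun h => h ^ 4 := (D.isBigO_comp R l).trans hR
  have r2 := (bil (pw 1 z₁) he₂ rfl).add ((bil he₂ (pw 1 z₁) rfl).add (bil he₁ he₁ rfl))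
  have r3 := (tri he₁ hd hd rfl).add
    ((tri (pw 1 z₁) he₁ hd rfl).add (tri (pw 1 z₁) (pw 1 z₁) he₁ rfl))
  have sum := ((t1.congr_right fun h => by ring).add r1).add
    ((r2.const_smul_left (1 / 2 : ℝ)).add (r3.const_smul_left (1 / 6 : ℝ)))
  refine sum.congr_left fun h => ?_
  have hz : x₀ + d h = Z h := by simp [d]
  have s12 := sym z₁ z₂
  simp only [Function.comp_def, hz, R, e₁, e₂, Pi.smul_apply, map_sub, map_smul, sub_apply,
    smul_apply, s12]
  module

/-! ### The stage equations -/

theorem exp_neg_smul_apply_expansion [CompleteSpace E] (A : E →L[ℝ] E) (v : E) (c : ℝ) :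
    (fun h : ℝ => NormedSpace.exp (-((c * h) • A)) v - (v - h • c • A v
      + h ^ 2 • (c ^ 2 / 2) • A (A v) - h ^ 3 • (c ^ 3 / 6) • A (A (A v))
      + h ^ 4 • (c ^ 4 / 24) • A (A (A (A v))))) =O[𝓝 0] fun h => h ^ 5 := by
  have h0 := (NormedSpace.exp_hasFPowerSeriesAt_zero (𝕂 := ℝ)
    (𝔸 := E →L[ℝ] E)).isBigO_sub_partialSum_pow 5
  have hlin : (fun h : ℝ => -((c * h) • A)) =O[𝓝 0] fun h => h :=
    IsBigO.of_bound (|c| * ‖A‖) (Eventually.of_forall fun h => by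
      rw [norm_neg, norm_smul, norm_mul, Real.norm_eq_abs c]
      exact le_of_eq (by ring))
  have ht : Tendsto (fun h : ℝ => -((c * h) • A)) (𝓝 0) (𝓝 0) := hlin.trans_tendsto tendsto_id
  have h1 := (h0.comp_tendsto ht).trans (hlin.norm_left.pow 5)
  have h2 := h1.clm_apply_mul (isBigO_const_const v (one_ne_zero' ℝ) (𝓝 (0 : ℝ)))
  refine (h2.congr_right fun h => mul_one _).congr_left fun h => ?_
  simp only [Function.comp_def, zero_add, FormalMultilinearSeries.partialSum,
    Finset.sum_range_succ, Finset.sum_range_zero, NormedSpace.expSeries_apply_eq]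
  simp [Nat.factorial, pow_succ, smul_apply, neg_apply]
  module

theorem norm_smul_sum_smul_le {ι : Type*} [Fintype ι] (a : ι → ι → ℝ) (i : ι) (h : ℝ)
    {w : ι → E} {c : ℝ} (hc : 0 ≤ c) (hw : ∀ j, ‖w j‖ ≤ c) :
    ‖h • ∑ j, a i j • w j‖ ≤ |h| * ((∑ i, ∑ j, |a i j|) * c) := by
  rw [norm_smul, Real.norm_eq_abs]
  gcongr
  calc ‖∑ j, a i j • w j‖ ≤ ∑ j, ‖a i j • w j‖ := norm_sum_le _ _
    _ ≤ ∑ j, |a i j| * c := Finset.sum_le_sum fun j _ => by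
        rw [norm_smul, Real.norm_eq_abs]
        exact mul_le_mul_of_nonneg_left (hw j) (abs_nonneg _)
    _ = (∑ j, |a i j|) * c := (Finset.sum_mul ..).symm
    _ ≤ (∑ i, ∑ j, |a i j|) * c := mul_le_mul_of_nonneg_right
        (Finset.single_le_sum (f := fun i => ∑ j, |a i j|)
          (fun i _ => Finset.sum_nonneg fun j _ => abs_nonneg _) (Finset.mem_univ i)) hc

/-- The right-hand side of the implicit stage equations is Lipschitz in the stages with a constant
proportional to the step size. -/
theorem dist_stageMap_le {ι : Type*} [Fintype ι] (a : ι → ι → ℝ) {f : E → E} {s : Set E}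
    {K : NNReal} (hf : LipschitzOnWith K f s) (e : ι → E) (h : ℝ) {Y Z : ι → E}
    (hY : ∀ i, Y i ∈ s) (hZ : ∀ i, Z i ∈ s) :
    dist (fun i => e i + h • ∑ j, a i j • f (Y j)) (fun i => e i + h • ∑ j, a i j • f (Z j))
      ≤ |h| * ((∑ i, ∑ j, |a i j|) * K) * dist Y Z := by
  have hS0 : 0 ≤ ∑ i, ∑ j, |a i j| :=
    Finset.sum_nonneg fun i _ => Finset.sum_nonneg fun j _ => abs_nonneg _
  refine (dist_pi_le_iff (by positivity)).2 fun i => ?_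
  have hfY : ∀ j, ‖f (Y j) - f (Z j)‖ ≤ K * dist Y Z := fun j => by
    rw [← dist_eq_norm]
    exact (hf.dist_le_mul _ (hY j) _ (hZ j)).trans (by gcongr; exact dist_le_pi_dist Y Z j)
  calc dist (e i + h • ∑ j, a i j • f (Y j)) (e i + h • ∑ j, a i j • f (Z j))
      = ‖h • ∑ j, a i j • (f (Y j) - f (Z j))‖ := by
        simp only [dist_eq_norm, smul_sub, Finset.sum_sub_distrib, add_sub_add_left_eq_sub]
    _ ≤ |h| * ((∑ i, ∑ j, |a i j|) * (K * dist Y Z)) :=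
        norm_smul_sum_smul_le a i h (by positivity) hfY
    _ = |h| * ((∑ i, ∑ j, |a i j|) * K) * dist Y Z := by ring

theorem eventually_abs_mul_le (c : ℝ) {ε : ℝ} (hε : 0 < ε) : ∀ᶠ h in 𝓝 (0 : ℝ), |h| * c ≤ ε := by
  have : Continuous fun h : ℝ => |h| * c := by fun_prop
  have : Tendsto (fun h : ℝ => |h| * c) (𝓝 0) (𝓝 0) := by simpa using this.tendsto 0
  exact this.eventually_le_const hε

/-- Stage equations with explicit parts `e i` tending to `x₀` have, for small `h`, exactly one
solution in a closed ball around `x₀` on which `f` is Lipschitz. -/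
theorem eventually_existsUnique_stages [CompleteSpace E] {ι : Type*} [Fintype ι] (a : ι → ι → ℝ)
    {f : E → E} {x₀ : E} {r : ℝ} (hr : 0 < r) {K : NNReal}
    (hf : LipschitzOnWith K f (closedBall x₀ r)) {e : ι → ℝ → E}
    (he : ∀ i, Tendsto (e i) (𝓝 0) (𝓝 x₀)) :
    ∀ᶠ h in 𝓝 (0 : ℝ), ∃! Y : ι → E, (∀ i, ‖Y i - x₀‖ ≤ r) ∧
      ∀ i, Y i = e i h + h • ∑ j, a i j • f (Y j) := by
  set S : ℝ := ∑ i, ∑ j, |a i j| with hS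
  set N : ℝ := ‖f x₀‖ + K * r with hN
  have hS0 : 0 ≤ S := Finset.sum_nonneg fun i _ => Finset.sum_nonneg fun j _ => abs_nonneg _
  have hN0 : 0 ≤ N := by positivity
  have close : ∀ᶠ h in 𝓝 (0 : ℝ), ∀ i, ‖e i h - x₀‖ ≤ r / 2 := by
    refine eventually_all.2 fun i => ?_
    filter_upwards [(he i).eventually (closedBall_mem_nhds x₀ (half_pos hr))] with h hh
    simpa [dist_eq_norm] using hh
  filter_upwards [eventually_abs_mul_le (S * N) (half_pos hr),
    eventually_abs_mul_le (S * K) one_half_pos, close]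
    with h h1 h2 h3
  let Φ : (ι → E) → (ι → E) := fun Y i => e i h + h • ∑ j, a i j • f (Y j)
  set s : Set (ι → E) := {Y | ∀ i, ‖Y i - x₀‖ ≤ r} with hs
  have hball : ∀ {Y : ι → E}, Y ∈ s → ∀ i, Y i ∈ closedBall x₀ r := fun hY i => by
    simpa [dist_eq_norm] using hY i
  have hmaps : Set.MapsTo Φ s s := fun Y hY i => by
    have hfY : ∀ j, ‖f (Y j)‖ ≤ N := fun j => by
      have := hf.dist_le_mul _ (hball hY j) _ (mem_closedBall_self hr.le)
      have h4 : dist (Y j) x₀ ≤ r := hball hY j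
      calc ‖f (Y j)‖ ≤ ‖f x₀‖ + ‖f (Y j) - f x₀‖ := by
            simpa using norm_add_le (f x₀) (f (Y j) - f x₀)
        _ ≤ ‖f x₀‖ + K * r := by
            rw [← dist_eq_norm]
            gcongr
            exact this.trans (by gcongr)
    calc ‖Φ Y i - x₀‖ = ‖(e i h - x₀) + h • ∑ j, a i j • f (Y j)‖ := by
          simp only [Φ]; congr 1; abel
      _ ≤ ‖e i h - x₀‖ + ‖h • ∑ j, a i j • f (Y j)‖ := norm_add_le _ _
      _ ≤ r / 2 + r / 2 := add_le_add (h3 i) ((norm_smul_sum_smul_le a i h hN0 hfY).trans h1)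
      _ = r := add_halves r
  have hcontr : ∀ Y ∈ s, ∀ Z ∈ s, dist (Φ Y) (Φ Z) ≤ 1 / 2 * dist Y Z := fun Y hY Z hZ =>
    (dist_stageMap_le a hf (fun i => e i h) h (hball hY) (hball hZ)).trans (by gcongr)
  have hcl : IsComplete s := by
    have : s = ⋂ i, {Y : ι → E | ‖Y i - x₀‖ ≤ r} := by ext; simp [hs]
    rw [this]
    exact (isClosed_iInter fun i => isClosed_le (by fun_prop) continuous_const).isComplete
  have hcw : ContractingWith (1 / 2) (hmaps.restrict Φ s s) :=
    ⟨by norm_num, LipschitzWith.of_dist_le_mul fun Y Z => by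
      simpa using! hcontr Y.1 Y.2 Z.1 Z.2⟩
  obtain ⟨Y, hY, hfix, -⟩ := hcw.exists_fixedPoint' hcl hmaps
    (x := fun _ => x₀) (by simp [hs, hr.le]) (edist_ne_top _ _)
  refine ⟨Y, ⟨hY, fun i => (congrFun hfix i).symm⟩, fun Z hZ => ?_⟩
  have hZfix : Φ Z = Z := funext fun i => (hZ.2 i).symm
  have := hcontr Z hZ.1 Y hY
  rw [hZfix, hfix] at this
  exact dist_le_zero.1 (by linarith [dist_nonneg (x := Z) (y := Y)])

theorem tendsto_quartic (x₀ z₁ z₂ z₃ z₄ : E) :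
    Tendsto (fun h : ℝ => x₀ + h • z₁ + h ^ 2 • z₂ + h ^ 3 • z₃ + h ^ 4 • z₄) (𝓝 0) (𝓝 x₀) := by
  have : Continuous fun h : ℝ => x₀ + h • z₁ + h ^ 2 • z₂ + h ^ 3 • z₃ + h ^ 4 • z₄ := by fun_prop
  simpa using this.tendsto 0

theorem isBigO_pow_smul_const {l : Filter ℝ} (n : ℕ) (v : E) :
    (fun h : ℝ => h ^ n • v) =O[l] fun h => h ^ n := by
  simpa using (isBigO_refl (fun h : ℝ => h ^ n) l).smul (isBigO_const_const v (one_ne_zero' ℝ) l)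

/-- The expansion of the stages up to `O(h⁴)`; `c` and `d` are the nodes and the sums
`∑ j, a i j * c j`. -/
theorem stages_expansion [CompleteSpace E] (a : Fin 2 → Fin 2 → ℝ) (A : E →L[ℝ] E)
    {f : E → E} {x₀ : E} (hf : ContDiffAt ℝ 4 f x₀) {r : ℝ} (hr : 0 < r) {K : NNReal}
    (hK : LipschitzOnWith K f (closedBall x₀ r)) {l : Filter ℝ} (hl : l ≤ 𝓝 0)
    {Y : ℝ → Fin 2 → E} {c d : Fin 2 → ℝ} (hc : ∀ i, c i = a i 0 + a i 1)
    (hd : ∀ i, d i = a i 0 * c 0 + a i 1 * c 1)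
    (hY : ∀ᶠ h in l, (∀ i, ‖Y h i - x₀‖ ≤ r) ∧
      ∀ i, Y h i = NormedSpace.exp (-((c i * h) • A)) x₀ + h • ∑ j, a i j • f (Y h j))
    {g : E} (hg : g = -A x₀ + f x₀) {z₂ z₃ : Fin 2 → E}
    (hz₂ : ∀ i, z₂ i = (c i ^ 2 / 2) • A (A x₀) + d i • fderiv ℝ f x₀ g)
    (hz₃ : ∀ i, z₃ i = -((c i ^ 3 / 6) • A (A (A x₀))) + ∑ j, a i j • (fderiv ℝ f x₀ (z₂ j)
      + (c j ^ 2 / 2) • fderiv ℝ (fderiv ℝ f) x₀ g g)) (i : Fin 2) :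
    (fun h : ℝ => Y h i - (x₀ + h • c i • g + h ^ 2 • z₂ i + h ^ 3 • z₃ i)) =O[l]
      fun h => h ^ 4 := by
  set P : ℝ → Fin 2 → E := fun h i => x₀ + h • c i • g + h ^ 2 • z₂ i + h ^ 3 • z₃ i with hP
  -- The stage map at step size `h`, whose fixed point is `Y h`.
  set Φ : ℝ → (Fin 2 → E) → Fin 2 → E := fun h Z i =>
    NormedSpace.exp (-((c i * h) • A)) x₀ + h • ∑ j, a i j • f (Z j) with hΦ
  have hfP : ∀ j, (fun h : ℝ => f (P h j) - (f x₀ + h • c j • fderiv ℝ f x₀ g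
      + h ^ 2 • (fderiv ℝ f x₀ (z₂ j) + (c j ^ 2 / 2) • fderiv ℝ (fderiv ℝ f) x₀ g g)))
      =O[l] fun h => h ^ 3 := fun j => by
    have h1 := hf.comp_cubic_expansion hl (Z := fun h => P h j) (z₁ := c j • g) (z₂ := z₂ j)
      (z₃ := z₃ j) (by simpa [hP] using isBigO_zero _ _)
    refine ((h1.trans (isBigO_pow_pow_of_le_nhds_zero hl (by norm_num))).add
      (isBigO_pow_smul_const 3 (fderiv ℝ f x₀ (z₃ j) + fderiv ℝ (fderiv ℝ f) x₀ (z₂ j) (c j • g)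
        + (1 / 6 : ℝ) • fderiv ℝ (fderiv ℝ (fderiv ℝ f)) x₀ (c j • g) (c j • g) (c j • g)))
      ).congr_left fun h => ?_
    simp only [map_smul, smul_apply]
    module
  have hres : ∀ i, (fun h => Φ h (P h) i - P h i) =O[l] fun h => h ^ 4 := fun i => by
    have h1 := (exp_neg_smul_apply_expansion A x₀ (c i)).mono hl
    have h2 : ∀ j, (fun h : ℝ => (h * a i j) • (f (P h j) - (f x₀ + h • c j • fderiv ℝ f x₀ g
      + h ^ 2 • (fderiv ℝ f x₀ (z₂ j) + (c j ^ 2 / 2) • fderiv ℝ (fderiv ℝ f) x₀ g g))))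
        =O[l] fun h => h ^ 4 := fun j =>
      (((isBigO_refl (fun h : ℝ => h) l).mul (isBigO_const_const (a i j) (one_ne_zero' ℝ) l)).smul
        (hfP j)).congr_right fun h => by rw [smul_eq_mul]; ring
    refine (((h1.trans (isBigO_pow_pow_of_le_nhds_zero hl (by norm_num))).add
      (isBigO_pow_smul_const 4 ((c i ^ 4 / 24) • A (A (A (A x₀)))))).add
      ((h2 0).add (h2 1))).congr_left fun h => ?_
    simp only [hΦ, hP, hz₃ i, hz₂ i, hg, hd i, hc i, Fin.sum_univ_two]
    module
  have hPball : ∀ i, ∀ᶠ h in l, P h i ∈ closedBall x₀ r := fun i => by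
    have := tendsto_quartic x₀ (c i • g) (z₂ i) (z₃ i) 0
    simp only [smul_zero, add_zero] at this
    exact hl (this.eventually (closedBall_mem_nhds x₀ hr))
  -- Since `Φ h` contracts with factor `1 / 2`, the distance from `P h` to the fixed point is at
  -- most twice the residual.
  have hmain : (fun h => Y h - P h) =O[l] fun h => Φ h (P h) - P h := by
    refine IsBigO.of_bound 2 ?_
    filter_upwards [hY, eventually_all.2 hPball,
      hl (eventually_abs_mul_le ((∑ i, ∑ j, |a i j|) * K) one_half_pos)] with h h1 h2 h3
    have h4 : Φ h (Y h) = Y h := funext fun i => (h1.2 i).symm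
    have h5 : dist (Φ h (Y h)) (Φ h (P h)) ≤ 1 / 2 * dist (Y h) (P h) :=
      (dist_stageMap_le a hK _ h (fun i => by simpa [dist_eq_norm] using h1.1 i) h2).trans
        (by gcongr)
    rw [h4] at h5
    rw [← dist_eq_norm, ← dist_eq_norm]
    linarith [dist_triangle (Y h) (Φ h (P h)) (P h)]
  exact (isBigO_pi.1 hmain i).trans ((isBigO_pi.2 hres))

/-! ### The exact solution -/

/-- The expansion of a solution of `y' = -A y + f(y)` up to `O(h⁵)`. The coefficients are those of
the quartic polynomial that satisfies the equation up to `O(h⁴)`. The expansion is one-sided because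
`y` solves the equation on `[t₀, t₁]` only. -/
theorem solution_expansion {A : E →L[ℝ] E}
    {f : E → E} {x₀ : E} (hf : ContDiffAt ℝ 4 f x₀) {r : ℝ} (hr : 0 < r) {K : NNReal}
    (hK : LipschitzOnWith K f (closedBall x₀ r)) {t₀ t₁ : ℝ} (ht : t₀ < t₁) {y : ℝ → E}
    (hy₀ : y t₀ = x₀)
    (hy : ∀ t ∈ Set.Icc t₀ t₁, HasDerivWithinAt y (-A (y t) + f (y t)) (Set.Icc t₀ t₁) t)
    {J : E →L[ℝ] E} (hJ : J = -A + fderiv ℝ f x₀) {z₁ z₂ z₃ z₄ : E}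
    (hz₁ : z₁ = -A x₀ + f x₀) (hz₂ : z₂ = (1 / 2 : ℝ) • J z₁)
    (hz₃ : z₃ = (1 / 3 : ℝ) • (J z₂ + (1 / 2 : ℝ) • fderiv ℝ (fderiv ℝ f) x₀ z₁ z₁))
    (hz₄ : z₄ = (1 / 4 : ℝ) • (J z₃ + fderiv ℝ (fderiv ℝ f) x₀ z₂ z₁
        + (1 / 6 : ℝ) • fderiv ℝ (fderiv ℝ (fderiv ℝ f)) x₀ z₁ z₁ z₁)) :
    (fun h : ℝ => y (t₀ + h) - (x₀ + h • z₁ + h ^ 2 • z₂ + h ^ 3 • z₃ + h ^ 4 • z₄))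
      =O[𝓝[>] 0] fun h => h ^ 5 := by
  set P : ℝ → E := fun h => x₀ + h • z₁ + h ^ 2 • z₂ + h ^ 3 • z₃ + h ^ 4 • z₄ with hP
  set P' : ℝ → E := fun h =>
    z₁ + (2 * h) • z₂ + (3 * h ^ 2) • z₃ + (4 * h ^ 3) • z₄ with hP'
  have hPd : ∀ h, HasDerivAt P (P' h) h := fun h => by
    have i := hasDerivAt_id h
    have := (((((i.smul_const z₁).const_add x₀).add ((i.pow 2).smul_const z₂)).add
      ((i.pow 3).smul_const z₃)).add ((i.pow 4).smul_const z₄))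
    convert! this using 1
    simp [hP']
  have hres : (fun h => P' h - (-A (P h) + f (P h))) =O[𝓝 0] fun h => h ^ 4 := by
    have h1 := hf.comp_cubic_expansion le_rfl (Z := P) (z₁ := z₁) (z₂ := z₂) (z₃ := z₃)
      ((isBigO_pow_smul_const 4 z₄).congr_left fun h => by simp only [hP]; abel)
    refine ((isBigO_pow_smul_const 4 (A z₄)).sub h1).congr_left fun h => ?_
    have e2 : A z₁ = fderiv ℝ f x₀ z₁ - (2 : ℝ) • z₂ := by
      rw [hz₂, hJ, add_apply, neg_apply]; module
    have e3 : A z₂ = fderiv ℝ f x₀ z₂ + (1 / 2 : ℝ) • fderiv ℝ (fderiv ℝ f) x₀ z₁ z₁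
        - (3 : ℝ) • z₃ := by
      rw [hz₃, hJ, add_apply, neg_apply]; module
    have e4 : A z₃ = fderiv ℝ f x₀ z₃ + fderiv ℝ (fderiv ℝ f) x₀ z₂ z₁
        + (1 / 6 : ℝ) • fderiv ℝ (fderiv ℝ (fderiv ℝ f)) x₀ z₁ z₁ z₁ - (4 : ℝ) • z₄ := by
      rw [hz₄, hJ, add_apply, neg_apply]; module
    have e1 : A x₀ = f x₀ - z₁ := by rw [hz₁]; abel
    have e5 : A (P h) = A x₀ + h • A z₁ + h ^ 2 • A z₂ + h ^ 3 • A z₃ + h ^ 4 • A z₄ := by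
      simp only [hP, map_add, map_smul]
    rw [e5, e1, e2, e3, e4]
    simp only [hP']
    module
  obtain ⟨C, hC, hres⟩ := hres.exists_nonneg
  have hycont : ContinuousOn y (Set.Icc t₀ t₁) := fun t h => (hy t h).continuousWithinAt
  have hyball : ∀ᶠ t in 𝓝[≥] t₀, y t ∈ closedBall x₀ r := by
    have := hycont t₀ (Set.left_mem_Icc.2 ht.le)
    rw [ContinuousWithinAt, hy₀, nhdsWithin_Icc_eq_nhdsGE ht] at this
    exact this.eventually (closedBall_mem_nhds x₀ hr)
  obtain ⟨δ, hδ, hδy⟩ := (mem_nhdsGE_iff_exists_Ico_subset).1 hyball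
  have hPball : ∀ᶠ h in 𝓝 (0 : ℝ), P h ∈ closedBall x₀ r :=
    (tendsto_quartic x₀ z₁ z₂ z₃ z₄).eventually (closedBall_mem_nhds x₀ hr)
  obtain ⟨η, hη, hηP⟩ := Metric.eventually_nhds_iff_ball.1 (hPball.and hres.bound)
  set κ : NNReal := ‖A‖₊ + K + 1 with hκ
  have hv : LipschitzOnWith κ (fun x => -A x + f x) (closedBall x₀ r) :=
    ((A.lipschitz.neg.lipschitzOnWith).add hK).weaken (by simp [hκ])
  refine IsBigO.of_bound (C * Real.exp κ) ?_
  have hh₁ : ∀ᶠ h in 𝓝[>] (0 : ℝ), h < min (min (δ - t₀) (t₁ - t₀)) (min η 1) :=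
    nhdsWithin_le_nhds (eventually_lt_nhds (by
      have : t₀ < δ := hδ
      simp [hη, ht, this]))
  filter_upwards [hh₁, self_mem_nhdsWithin] with h hh hpos
  replace hpos : 0 < h := hpos
  simp only [lt_min_iff] at hh
  obtain ⟨⟨hh1, hh2⟩, hh3, hh4⟩ := hh
  -- Grönwall's inequality on `[t₀, t₀ + h]` for the exact `y` and the approximate solution `P`.
  have gr := dist_le_of_approx_trajectories_ODE_of_mem (v := fun _ x => -A x + f x)
    (s := fun _ => closedBall x₀ r) (f := y) (g := fun t => P (t - t₀))
    (f' := fun t => -A (y t) + f (y t)) (g' := fun t => P' (t - t₀)) (a := t₀) (b := t₀ + h)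
    (εf := 0) (εg := C * h ^ 4) (δ := 0) (K := κ) (fun _ _ => hv)
    (hycont.mono (Set.Icc_subset_Icc le_rfl (by linarith)))
    (fun t ht' => (hy t ⟨ht'.1, by linarith [ht'.2]⟩).mono_of_mem_nhdsWithin
      (mem_of_superset (Icc_mem_nhdsGE (by linarith [ht'.2] : t < t₁))
        (Set.Icc_subset_Icc ht'.1 le_rfl)))
    (fun t _ => by simp)
    (fun t ht' => hδy ⟨ht'.1, by linarith [ht'.2]⟩)
    (fun t _ => ((hPd (t - t₀)).continuousAt.comp
      (f := fun t => t - t₀) (by fun_prop)).continuousWithinAt)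
    (fun t _ => ((hPd (t - t₀)).comp_sub_const t t₀).hasDerivWithinAt)
    (fun t ht' => by
      have h1 : |t - t₀| ≤ h := by
        rw [abs_of_nonneg (by linarith [ht'.1])]; linarith [ht'.2]
      have h2 := (hηP (t - t₀) (by rw [mem_ball_zero_iff, Real.norm_eq_abs]; linarith)).2
      rw [dist_eq_norm]
      refine h2.trans ?_
      rw [norm_pow, Real.norm_eq_abs]
      gcongr)
    (fun t ht' => (hηP (t - t₀) (by
      rw [mem_ball_zero_iff, Real.norm_eq_abs, abs_of_nonneg (by linarith [ht'.1])]
      linarith [ht'.2])).1)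
    (by simp [hP, hy₀]) (t₀ + h) ⟨by linarith, le_rfl⟩
  rw [dist_eq_norm] at gr
  simp only [add_sub_cancel_left, zero_add] at gr
  refine gr.trans ?_
  have hκ0 : (0 : ℝ) < κ := by rw [hκ]; positivity
  rw [gronwallBound_of_K_ne_0 hκ0.ne', norm_pow, Real.norm_of_nonneg hpos.le]
  simp only [zero_mul, zero_add]
  -- `exp x - 1 ≤ x * exp x`, a rearrangement of `1 - x ≤ exp (-x)`.
  have hexp : Real.exp (κ * h) - 1 ≤ κ * h * Real.exp κ := by
    have h1 := Real.add_one_le_exp (-(κ * h))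
    have h2 : Real.exp (κ * h) * Real.exp (-(κ * h)) = 1 := by rw [← Real.exp_add]; simp
    have h3 : Real.exp (κ * h) ≤ Real.exp κ := Real.exp_le_exp.2 (by nlinarith)
    have h4 := Real.exp_pos (κ * h)
    have h5 : 0 < κ * h := by positivity
    nlinarith
  calc C * h ^ 4 / κ * (Real.exp (κ * h) - 1) ≤ C * h ^ 4 / κ * (κ * h * Real.exp κ) := by gcongr
    _ = C * Real.exp κ * h ^ 5 := by field_simp

end Expansions

namespace IMSVERK

set_option maxSynthPendingDepth 3

open Asymptotics Filter Topology Metric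

/-! ### The order conditions suffice -/

/-- The local error of the method is `O(h⁵)`: the powers of `h` up to the fourth agree. -/
theorem Tableau.OrderConditions.update_sub_solution_isBigO {T : Tableau 2} (hT : T.OrderConditions)
    {m : ℕ} (M : Matrix (Fin m) (Fin m) ℝ)
    {f : EuclideanSpace ℝ (Fin m) → EuclideanSpace ℝ (Fin m)} {y₀ : EuclideanSpace ℝ (Fin m)}
    (hf : ContDiffAt ℝ 4 f y₀) {r : ℝ} (hr : 0 < r) {K : NNReal}
    (hK : LipschitzOnWith K f (closedBall y₀ r)) {t₀ tEnd : ℝ} (ht : t₀ < tEnd)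
    {y : ℝ → EuclideanSpace ℝ (Fin m)} (hy : IsSolution M f t₀ tEnd y₀ y)
    {Y : ℝ → Fin 2 → EuclideanSpace ℝ (Fin m)}
    (hY : ∀ᶠ h in 𝓝[>] 0, (∀ i, ‖Y h i - y₀‖ ≤ r) ∧ T.IsStages M f y₀ h (Y h)) :
    (fun h => T.update M f y₀ h (Y h) - y (t₀ + h)) =O[𝓝[>] 0] fun h => h ^ 5 := by
  have hl : 𝓝[>] (0 : ℝ) ≤ 𝓝 0 := nhdsWithin_le_nhds
  set A := op M with hA
  obtain ⟨g, hg⟩ : ∃ g, g = -A y₀ + f y₀ := ⟨_, rfl⟩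
  have hAy : A y₀ = f y₀ - g := by rw [hg]; abel
  set d : Fin 2 → ℝ := fun i => T.a i 0 * T.c 0 + T.a i 1 * T.c 1 with hd
  have hsol := solution_expansion (A := A) hf hr hK ht hy.1 hy.2 rfl hg rfl rfl rfl
  have hst := stages_expansion T.a A hf hr hK hl (c := T.c) (d := d)
    (fun i => by simp [Tableau.c, Fin.sum_univ_two]) (fun i => rfl) hY hg
    (fun i => rfl) (fun i => rfl)
  have hfY := fun i => hf.comp_cubic_expansion hl (hst i)
  have hbf : ∀ i, _ := fun i =>
    ((isBigO_refl (fun h : ℝ => h) (𝓝[>] 0)).mul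
      (isBigO_const_const (T.b i) (one_ne_zero' ℝ) _)).smul (hfY i)
  have hexp := (exp_neg_smul_apply_expansion A y₀ 1).mono hl
  refine (((hexp.add (((hbf 0).add (hbf 1)).congr_right fun h => by rw [smul_eq_mul]; ring)).sub
    hsol).congr_left fun h => ?_)
  obtain ⟨c1, c2, c3, c4, c5, c6, c7, c8⟩ := hT
  simp only [Tableau.update, w4, expNeg, ← hA, ← hg, Fin.sum_univ_two, one_mul]
  generalize NormedSpace.exp (-(h • A)) y₀ = ex
  generalize y (t₀ + h) = yh
  generalize f (Y h 0) = f0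
  generalize f (Y h 1) = f1
  rw [hAy]
  generalize f y₀ = v
  generalize fderiv ℝ f y₀ = F
  generalize fderiv ℝ (fderiv ℝ f) y₀ = B
  generalize fderiv ℝ (fderiv ℝ (fderiv ℝ f)) y₀ = D
  simp only [hd, map_add, map_sub, map_smul, map_neg, add_apply, sub_apply, smul_apply, neg_apply]
  -- With `M y₀` replaced by `f(y₀) - g` both sides are combinations of words in `M`, `f'`, `f''`,
  -- `f'''` applied to `f(y₀)` and `g`; each order condition is weighted with the words it governs.
  linear_combination (norm := module)
    -(c1 • (h • v) + c2 • (h ^ 2 • F g)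
      + c3 • (h ^ 3 • (1 / 2 : ℝ) • (F (A v) - F (A g) + B g g)) + c4 • (h ^ 3 • F (F g))
      + c5 • (h ^ 4 • ((1 / 6 : ℝ) • (F (A (A g)) - F (A (A v)) + D g g g)
          + (1 / 2 : ℝ) • (B (A v) g - B (A g) g)))
      + c6 • (h ^ 4 • B (F g) g)
      + c7 • (h ^ 4 • (1 / 2 : ℝ) • (F (F (A v)) - F (F (A g)) + F (B g g)))
      + c8 • (h ^ 4 • F (F (F g))))

theorem Tableau.OrderConditions.hasOrder {T : Tableau 2} (hT : T.OrderConditions) {k : ℕ∞}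
    (hk : 4 ≤ k) : T.HasOrder k 4 := by
  intro m M _ f y₀ hf t₀ tEnd ht y hy
  replace hf : ContDiffAt ℝ 4 f y₀ :=
    hf.of_le (WithTop.coe_le_coe.2 hk : ((4 : ℕ∞) : WithTop ℕ∞) ≤ k)
  obtain ⟨K, s, hs, hKs⟩ := (hf.of_le (m := 1) (by norm_num)).exists_lipschitzOnWith
  obtain ⟨r, hr, hrs⟩ := Metric.nhds_basis_closedBall.mem_iff.1 hs
  have hK := hKs.mono hrs
  have hstage : ∀ᶠ h in 𝓝[>] (0 : ℝ), ∃! Y : Fin 2 → EuclideanSpace ℝ (Fin m),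
      (∀ i, ‖Y i - y₀‖ ≤ r) ∧ T.IsStages M f y₀ h Y :=
    nhdsWithin_le_nhds <| eventually_existsUnique_stages T.a hr hK
      (e := fun i h => expNeg M (T.c i * h) y₀) fun i => by
        have h1 : ContinuousAt (NormedSpace.exp :
            (EuclideanSpace ℝ (Fin m) →L[ℝ] EuclideanSpace ℝ (Fin m)) → _) 0 :=
          (NormedSpace.exp_hasFPowerSeriesAt_zero (𝕂 := ℝ)).continuousAt
        have h2 : Tendsto (fun h : ℝ => -((T.c i * h) • op M)) (𝓝 0) (𝓝 0) := by
          have : Continuous fun h : ℝ => -((T.c i * h) • op M) := by fun_prop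
          simpa using this.tendsto 0
        have h3 := ((ContinuousLinearMap.apply ℝ (EuclideanSpace ℝ (Fin m)) y₀).continuous.tendsto
          _).comp (h1.tendsto.comp h2)
        simpa [expNeg, Function.comp_def] using h3
  -- Choose the stages as a function of `h`, so that the expansions apply to them.
  have hex : ∀ h, ∃ Y : Fin 2 → EuclideanSpace ℝ (Fin m),
      (∃! Y : Fin 2 → EuclideanSpace ℝ (Fin m),
        (∀ i, ‖Y i - y₀‖ ≤ r) ∧ T.IsStages M f y₀ h Y) →
      (∀ i, ‖Y i - y₀‖ ≤ r) ∧ T.IsStages M f y₀ h Y := fun h => by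
    by_cases hh : ∃! Y : Fin 2 → EuclideanSpace ℝ (Fin m),
        (∀ i, ‖Y i - y₀‖ ≤ r) ∧ T.IsStages M f y₀ h Y
    · exact ⟨_, fun _ => hh.exists.choose_spec⟩
    · exact ⟨0, fun h' => absurd h' hh⟩
  choose Y hY using hex
  obtain ⟨C, hC⟩ := (hT.update_sub_solution_isBigO M hf hr hK ht hy
    (hstage.mono fun h hh => hY h hh)).bound
  obtain ⟨h₀, hh₀, hmem⟩ := mem_nhdsGT_iff_exists_Ioc_subset.1 (hstage.and hC)
  refine ⟨h₀, hh₀, r, hr, C, fun h hpos hle => ?_⟩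
  obtain ⟨h1, h2⟩ := hmem ⟨hpos, hle⟩
  refine ⟨h1, fun Z hZ hZs => ?_⟩
  rw [h1.unique ⟨hZ, hZs⟩ (hY h h1)]
  simpa [abs_of_pos hpos] using h2

/-! ### Order conditions from test problems -/

/-- If the local error is the single term `h ^ (d + 1) * (S - γ)` with `d < p` and is bounded by
`C * h ^ (p + 1)`, then its coefficient vanishes. -/
theorem eq_of_forall_abs_pow_mul_sub_le {S γ C h₀ : ℝ} {d p : ℕ} (hdp : d < p) (hh₀ : 0 < h₀)
    (H : ∀ h, 0 < h → h ≤ h₀ → |h ^ (d + 1) * (S - γ)| ≤ C * h ^ (p + 1)) : S = γ := by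
  have key : ∀ᶠ h in 𝓝[>] (0 : ℝ), |S - γ| ≤ C * h ^ (p - d) := by
    filter_upwards [Ioc_mem_nhdsGT hh₀] with h hh
    have h1 := H h hh.1 hh.2
    have hp : 0 < h ^ (d + 1) := pow_pos hh.1 _
    rw [abs_mul, abs_of_pos hp, show p + 1 = (d + 1) + (p - d) by omega, pow_add h (d + 1)] at h1
    exact le_of_mul_le_mul_left (by linarith) hp
  have lim : Tendsto (fun h : ℝ => C * h ^ (p - d)) (𝓝[>] 0) (𝓝 0) := by
    have : Continuous fun h : ℝ => C * h ^ (p - d) := by fun_prop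
    have h0 := this.tendsto 0
    simp only [zero_pow (show p - d ≠ 0 by omega), mul_zero] at h0
    exact h0.mono_left nhdsWithin_le_nhds
  have := ge_of_tendsto lim key
  exact sub_eq_zero.1 (abs_eq_zero.1 (le_antisymm this (abs_nonneg _)))

/-- The order condition obtained from the classical problem `M = 0`,
`f(x) = (1, x₀, x₀ ^ q * x₁ ^ e)`, with solution
`(t, t² / 2, t ^ (q + 2e + 1) / (2 ^ e * (q + 2e + 1)))`. -/
theorem Tableau.HasOrder.sum_monomial_eq {s : ℕ} {T : Tableau s} {k : ℕ∞} {p : ℕ}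
    (hT : T.HasOrder k p) {q e : ℕ} (hqe : q + 2 * e < p) :
    ∑ i, T.b i * (T.c i ^ q * (∑ j, T.a i j * T.c j) ^ e) = 1 / (2 ^ e * (q + 2 * e + 1)) := by
  let f : EuclideanSpace ℝ (Fin 3) → EuclideanSpace ℝ (Fin 3) :=
    fun x => !₂[1, x 0, x 0 ^ q * x 1 ^ e]
  let y : ℝ → EuclideanSpace ℝ (Fin 3) := fun t =>
    !₂[t, t ^ 2 / 2, t ^ (q + 2 * e + 1) * (1 / (2 ^ e * (q + 2 * e + 1)))]
  have hf : ContDiff ℝ k f := by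
    rw [contDiff_euclidean]
    intro i
    fin_cases i <;> simp [f] <;> fun_prop
  have hy : IsSolution (0 : Matrix (Fin 3) (Fin 3) ℝ) f 0 1 0 y := by
    refine ⟨?_, fun t _ => ?_⟩
    · ext i; fin_cases i <;> simp [y]
    · refine HasDerivAt.hasDerivWithinAt ?_
      have : HasDerivAt (fun t : ℝ => ![t, t ^ 2 / 2,
          t ^ (q + 2 * e + 1) * (1 / (2 ^ e * (q + 2 * e + 1)))])
          ![1, t, t ^ q * (t ^ 2 / 2) ^ e] t := by
        rw [hasDerivAt_pi]
        intro i
        fin_cases i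
        · simpa using! hasDerivAt_id t
        · simpa using (hasDerivAt_pow 2 t).div_const 2
        · have := (hasDerivAt_pow (q + 2 * e + 1) t).mul_const
            (1 / (2 ^ e * (q + 2 * e + 1) : ℝ))
          simp only [Fin.reduceFinMk, Matrix.cons_val]
          convert! this using 1
          have : (q + 2 * e + 1 : ℝ) ≠ 0 := by positivity
          push_cast
          rw [div_pow]
          field_simp
          ring
      have h2 := ((EuclideanSpace.equiv (Fin 3) ℝ).symm : _ ≃L[ℝ] _).hasFDerivAt.comp_hasDerivAt t
        this
      convert! h2 using 1
      simp [op, f, y]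
  obtain ⟨h₀, hh₀, r, hr, C, H⟩ := hT 3 0 (Or.inr (by simp)) f 0 hf.contDiffAt 0 1 one_pos y hy
  refine eq_of_forall_abs_pow_mul_sub_le hqe hh₀ (C := C) fun h hpos hle => ?_
  obtain ⟨⟨Y, ⟨hYr, hY⟩, -⟩, hbound⟩ := H h hpos hle
  have hb := (PiLp.norm_apply_le _ 2).trans (hbound Y hYr hY)
  have hY0 : ∀ i, Y i 0 = h * T.c i := fun i => by
    have := congrArg (fun v : EuclideanSpace ℝ (Fin 3) => v 0) (hY i)
    simpa [expNeg, f, Tableau.c] using this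
  have hY1 : ∀ i, Y i 1 = h ^ 2 * ∑ j, T.a i j * T.c j := fun i => by
    have := congrArg (fun v : EuclideanSpace ℝ (Fin 3) => v 1) (hY i)
    simp [expNeg, f, hY0] at this
    rw [this, Finset.mul_sum, Finset.mul_sum]
    exact Finset.sum_congr rfl fun j _ => by ring
  rw [Real.norm_eq_abs] at hb
  refine le_of_eq_of_le (congrArg _ ?_) hb
  simp [Tableau.update, expNeg, w4, f, y, hY0, hY1]
  rw [mul_sub, Finset.mul_sum, Finset.mul_sum]
  congr 1
  exact Finset.sum_congr rfl fun i _ => by rw [mul_pow, mul_pow]; ring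

/-! ### Solving the order conditions -/

/-- The coefficients with nodes `1/2 - δ`, `1/2 + δ`. The values `δ = √3 / 6` and `δ = -√3 / 6` give
`gaussLegendre` with its two numberings of the stages, which this parametrization treats at once. -/
noncomputable def gaussTableau (δ : ℝ) : Tableau 2 where
  a := ![![1 / 4, 1 / 4 - δ], ![1 / 4 + δ, 1 / 4]]
  b := ![1 / 2, 1 / 2]

theorem sq_sqrt_three_div_six : (√3 / 6) ^ 2 = 1 / 12 := by
  rw [div_pow, Real.sq_sqrt (by norm_num)]
  norm_num

theorem gaussTableau_sqrt : gaussTableau (√3 / 6) = gaussLegendre := by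
  ext i j
  · fin_cases i <;> fin_cases j <;> simp [gaussTableau, gaussLegendre] <;> ring
  · simp [gaussTableau, gaussLegendre]

theorem gaussTableau_neg_sqrt : gaussTableau (-(√3 / 6)) = gaussLegendre.rev := by
  ext i j
  · fin_cases i <;> fin_cases j <;> simp [gaussTableau, gaussLegendre, Tableau.rev] <;> ring
  · fin_cases i <;> simp [gaussTableau, gaussLegendre, Tableau.rev]

theorem gaussTableau_orderConditions {δ : ℝ} (hδ : δ ^ 2 = 1 / 12) :
    (gaussTableau δ).OrderConditions := by
  constructor <;> simp [gaussTableau, Tableau.c, Fin.sum_univ_two]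
  · norm_num
  · ring
  · linear_combination hδ
  · linear_combination -hδ
  · linear_combination (3 / 2) * hδ
  · ring
  · linear_combination -(1 / 2) * hδ
  · linear_combination -hδ

/-- The first six order conditions determine the tableau up to the numbering of the stages. -/
theorem Tableau.eq_gaussLegendre_or_rev {T : Tableau 2}
    (c1 : T.b 0 + T.b 1 = 1) (c2 : T.b 0 * T.c 0 + T.b 1 * T.c 1 = 1 / 2)
    (c3 : T.b 0 * T.c 0 ^ 2 + T.b 1 * T.c 1 ^ 2 = 1 / 3)
    (c4 : T.b 0 * (T.a 0 0 * T.c 0 + T.a 0 1 * T.c 1)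
      + T.b 1 * (T.a 1 0 * T.c 0 + T.a 1 1 * T.c 1) = 1 / 6)
    (c5 : T.b 0 * T.c 0 ^ 3 + T.b 1 * T.c 1 ^ 3 = 1 / 4)
    (c6 : T.b 0 * T.c 0 * (T.a 0 0 * T.c 0 + T.a 0 1 * T.c 1)
      + T.b 1 * T.c 1 * (T.a 1 0 * T.c 0 + T.a 1 1 * T.c 1) = 1 / 8) :
    T = gaussLegendre ∨ T = gaussLegendre.rev := by
  have hc0 : T.a 0 0 + T.a 0 1 = T.c 0 := by simp [Tableau.c, Fin.sum_univ_two]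
  have hc1 : T.a 1 0 + T.a 1 1 = T.c 1 := by simp [Tableau.c, Fin.sum_univ_two]
  -- The moments `∑ b i * c i ^ n` satisfy the recursion with characteristic roots `c 0`, `c 1`; two
  -- steps of it determine the sum and the product of the nodes.
  have r1 : 1 / 3 = (T.c 0 + T.c 1) / 2 - T.c 0 * T.c 1 := by
    linear_combination (T.c 0 + T.c 1) * c2 - T.c 0 * T.c 1 * c1 - c3
  have r2 : 1 / 4 = (T.c 0 + T.c 1) / 3 - T.c 0 * T.c 1 / 2 := by
    linear_combination (T.c 0 + T.c 1) * c3 - T.c 0 * T.c 1 * c2 - c5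
  have hsum : T.c 0 + T.c 1 = 1 := by linear_combination 6 * r1 - 12 * r2
  have hprod : T.c 0 * T.c 1 = 1 / 6 := by linarith
  obtain ⟨δ, hδ⟩ : ∃ δ, δ = 1 / 2 - T.c 0 := ⟨_, rfl⟩
  have e0 : T.c 0 = 1 / 2 - δ := by linarith
  have e1 : T.c 1 = 1 / 2 + δ := by linarith
  rw [e0] at c2 c3 c4 c5 c6 hc0 hprod
  rw [e1] at c2 c3 c4 c5 c6 hc1 hprod
  have hδ2 : δ ^ 2 = 1 / 12 := by linear_combination -hprod
  have hδ0 : δ ≠ 0 := fun h => by norm_num [h] at hδ2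
  have hb : T.b 1 = T.b 0 := mul_left_cancel₀ hδ0 (by linear_combination c2 - 1 / 2 * c1)
  have b0 : T.b 0 = 1 / 2 := by linarith
  have b1 : T.b 1 = 1 / 2 := by linarith
  rw [b0, b1] at c4 c6
  have hT : T = gaussTableau δ := by
    have a01 : T.a 0 1 = T.c 0 - T.a 0 0 := by linarith
    have a10 : T.a 1 0 = T.c 1 - T.a 1 1 := by linarith
    rw [a01, a10, e0, e1] at c4 c6
    have hdiag : T.a 1 1 = T.a 0 0 := mul_left_cancel₀ hδ0 (by linear_combination c4 + hδ2)
    rw [hdiag] at c6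
    have h00 : T.a 0 0 = 1 / 4 := by
      linear_combination 6 * c6 - (12 * T.a 0 0 - 3) * hδ2
    ext i j
    · fin_cases i <;> fin_cases j <;> simp [gaussTableau] <;> linarith
    · fin_cases i <;> simp [gaussTableau] <;> linarith
  rcases sq_eq_sq_iff_eq_or_eq_neg.1 (hδ2.trans sq_sqrt_three_div_six.symm) with h | h
  · exact Or.inl (by rw [hT, h, gaussTableau_sqrt])
  · exact Or.inr (by rw [hT, h, gaussTableau_neg_sqrt])

theorem Tableau.HasOrder.eq_gaussLegendre_or_rev {T : Tableau 2} {k : ℕ∞} (hT : T.HasOrder k 4) :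
    T = gaussLegendre ∨ T = gaussLegendre.rev := by
  have key := fun (q e : ℕ) (h : q + 2 * e < 4) => hT.sum_monomial_eq h
  simp only [Fin.sum_univ_two] at key
  refine T.eq_gaussLegendre_or_rev ?_ ?_ ?_ ?_ ?_ ?_
  · linear_combination key 0 0 (by norm_num)
  · linear_combination key 1 0 (by norm_num)
  · linear_combination key 2 0 (by norm_num)
  · linear_combination key 0 1 (by norm_num)
  · linear_combination key 3 0 (by norm_num)
  · linear_combination key 1 1 (by norm_num)

theorem Tableau.orderConditions_iff (T : Tableau 2) :
    T.OrderConditions ↔ T = gaussLegendre ∨ T = gaussLegendre.rev := by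
  refine ⟨fun h => T.eq_gaussLegendre_or_rev h.cond1 h.cond2 h.cond3 h.cond4 h.cond5 h.cond6, ?_⟩
  rintro (rfl | rfl)
  · exact gaussTableau_sqrt ▸ gaussTableau_orderConditions sq_sqrt_three_div_six
  · exact gaussTableau_neg_sqrt ▸
      gaussTableau_orderConditions (by rw [neg_sq, sq_sqrt_three_div_six])

end IMSVERK

theorem mainTheorem4 (k : ℕ∞) (hk : 4 ≤ k) :
    (∀ T : IMSVERK.Tableau 2, T.OrderConditions → T.HasOrder k 4) ∧
    (∀ T : IMSVERK.Tableau 2, T.OrderConditions ↔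
      T = IMSVERK.gaussLegendre ∨ T = IMSVERK.gaussLegendre.rev) ∧
    (∀ T : IMSVERK.Tableau 2, T.HasOrder k 4 ↔
      T = IMSVERK.gaussLegendre ∨ T = IMSVERK.gaussLegendre.rev) ∧
    IMSVERK.gaussLegendre.c = ![(3 - √3) / 6, (3 + √3) / 6] := by
  refine ⟨fun T hT => hT.hasOrder hk, fun T => T.orderConditions_iff,
    fun T => ⟨fun h => h.eq_gaussLegendre_or_rev,
      fun h => ((T.orderConditions_iff).2 h).hasOrder hk⟩, ?_⟩
  ext i
  fin_cases i <;> simp [IMSVERK.Tableau.c, IMSVERK.gaussLegendre, Fin.sum_univ_two] <;> ring
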